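/- \textbf{Setting.} For $u(t,x)$ on $\mathbb R\times\mathbb R$ put $U=-i\lambda\sigma_3+Q$, $Q=\begin{pmatrix}0&u\\-u^*&0\end{pmatrix}$, $\sigma_3=\mathrm{diag}(1,-1)$, $\theta(t,x,\lambda)=\lambda x+2\lambda^2t$ (Lax pair of the focusing NLS equation $iu_t+u_{xx}+2|u|^2u=0$). For $\operatorname{Im}\lambda>0$ let $\psi_-^{(1)},\psi_+^{(2)}$ be the Jost solutions of $\psi_x=U\psi$ with $e^{i\theta}\psi_-^{(1)}\to(1,0)^{\top}$ as $x\to-\infty$ and $e^{-i\theta}\psi_+^{(2)}\to(0,1)^{\top}$ as $x\to+\infty$, and let $a_{11}(\lambda)=\det[\psi_-^{(1)}|\psi_+^{(2)}]$. At a simple zero $\zeta$ of $a_{11}$ with $\psi_-^{(1)}=b\,\psi_+^{(2)}$ the weight is $C=b/a_{11}'(\zeta)$. If $\eta=\operatorname{Im}\zeta$, the position $x_0$ and the phase $\phi_0$ (modulo $2\pi$) are defined by $C=2\eta\,e^{2\eta x_0+i\phi_0}$. The $M$-fold Darboux transformation with parameters $\mu_1,\dots,\mu_M$ and vector solutions $\Psi_1,\dots,\Psi_M$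 is $D[M]=\prod_{j=M}^{1}\bigl((\lambda-\mu_j^*)I+(\mu_j^*-\mu_j)P[j]\bigr)$ (factors ordered from left to right as $j=M,\dots,1$), where $P[j]$ is the orthogonal projector onto the line spanned by $D[j-1]|_{\lambda=\mu_j}\Psi_j$; the dressed potential is $Q[M]=Q[0]-i\sum_j(\mu_j-\mu_j^*)[\sigma_3,P[j]]$. \textbf{Statement.} Let $\alpha,\beta\in\mathbb R\setminus\{0\}$, $\lambda_0=-\frac{\alpha+i\beta}2$, and let $\lambda_j=\xi_j+i\eta_j$, $j=1,\dots,N$, satisfy $\xi_j\ne0$, $\eta_j>0$, $\lambda_j\notin\{\pm\lambda_0,\pm\lambda_0^*\}$. Put $\widehat\lambda_j=-\lambda_j$, so $\widehat\lambda_j^*=-\xi_j+i\eta_j$, and assume that the $2N$ numbers $\lambda_1,\dots,\lambda_N,\widehat\lambda_1^*,\dots,\widehat\lambda_N^*$ are distinct. Let $\psi_j=e^{-i(\lambda_jx+2\lambda_j^2t)\sigma_3}(u_j,v_j)^{\top}$ with $u_j,v_j\in\mathbb C\setminus\{0\}$, and let $\widehat\psi_j=e^{-i(\widehat\lambda_jx+2\widehat\lambda_j^2t)\sigma_3}(\hat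 u_j,\hat v_j)^{\top}$ satisfy $\widehat\psi_j|_{x=0}=K_0(\lambda_j)\psi_j|_{x=0}$, where $$K_0(\lambda)=\frac1{(2\lambda-i|\beta|)^2-\alpha^2}\,\mathrm{diag}\bigl(4\lambda^2+4i\lambda|\beta|-(\alpha^2+\beta^2),\;4\lambda^2-4i\lambda|\beta|-(\alpha^2+\beta^2)\bigr).$$ For $\widehat\psi_j=(\hat\mu_j,\hat\nu_j)^{\top}$ put $\widehat\varphi_j=(-\hat\nu_j^*,\hat\mu_j^*)^{\top}$. Let $u$ be the solution obtained from the zero seed $u[0]=0$ by the $2N$-fold Darboux transformation with $\{\lambda_1,\psi_1,\dots,\lambda_N,\psi_N,\widehat\lambda_1^*,\widehat\varphi_1,\dots,\widehat\lambda_N^*,\widehat\varphi_N\}$. Then for every $j$ the weights $C_j$ of $u$ at $\lambda_j$ and $\widehat C_j$ at $\widehat\lambda_j^*$ exist, are uniquely determined, do not depend on $t$, and are nonzero, and $$C_j\widehat C_j^*=-4\lambda_j^2\,\frac{(2\lambda_j+i|\beta|)^2-\alpha^2}{(2\lambda_j-i|\beta|)^2-\alpha^2}\,\frac{(2\eta_j)^2}{(2\xi_j)^2}\Bigl[\prod_{k\ne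 j}\frac{(\lambda_j-\lambda_k^*)(\lambda_j+\lambda_k)}{(\lambda_j-\lambda_k)(\lambda_j+\lambda_k^*)}\Bigr]^2 .$$ For the positions $x_j,\widehat x_j$ and phases $\phi_j,\widehat\phi_j$ belonging to $C_j,\widehat C_j$, $$x_j+\widehat x_j=\frac1{2\eta_j}\log\Bigl(1+\frac{\eta_j^2}{\xi_j^2}\Bigr)+\frac1{4\eta_j}\log\frac{(4\xi_j^2-\alpha^2-(2\eta_j+|\beta|)^2)^2+(4\xi_j(2\eta_j+|\beta|))^2}{(4\xi_j^2-\alpha^2-(2\eta_j-|\beta|)^2)^2+(4\xi_j(2\eta_j-|\beta|))^2}$$ $$\qquad-\frac1{2\eta_j}\sum_{k\ne j}\log\frac{[(\xi_j-\xi_k)^2+(\eta_j-\eta_k)^2][(\xi_j+\xi_k)^2+(\eta_j-\eta_k)^2]}{[(\xi_j+\xi_k)^2+(\eta_j+\eta_k)^2][(\xi_j-\xi_k)^2+(\eta_j+\eta_k)^2]},$$ and, modulo $2\pi$, $$\phi_j-\widehat\phi_j\equiv2\arg\lambda_j+\arg\frac{4\xi_j^2-\alpha^2-(2\eta_j+|\beta|)^2+4i\xi_j(2\eta_j+|\beta|)}{4\xi_j^2-\alpha^2-(2\eta_j-|\beta|)^2+4i\xi_j(2\eta_j-|\beta|)}+\pi$$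 $$\qquad-2\sum_{k\ne j}\arg\frac{[(\xi_j-\xi_k)+i(\eta_j-\eta_k)][(\xi_j+\xi_k)+i(\eta_j-\eta_k)]}{[(\xi_j+\xi_k)+i(\eta_j+\eta_k)][(\xi_j-\xi_k)+i(\eta_j+\eta_k)]}.$$ -/

import Mathlib

open Matrix Filter Topology
open scoped ComplexConjugate

noncomputable section

namespace NLSDressing

/-- The matrix `diag (1, -1)`. -/
def sigmaThree : Matrix (Fin 2) (Fin 2) ℂ := !![1, 0; 0, -1]

/-- The off-diagonal potential with upper right entry `w`. -/
def potential (w : ℂ) : Matrix (Fin 2) (Fin 2) ℂ := !![0, w; -conj w, 0]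

/-- The matrix `U = -i z σ₃ + Q` of the `x` part of the Lax pair, at spectral parameter `z` and
at a point where the solution of the NLS equation has the value `w`. -/
def laxU (z w : ℂ) : Matrix (Fin 2) (Fin 2) ℂ := -(Complex.I * z) • sigmaThree + potential w

/-- The phase `θ(t, x, z) = z x + 2 z² t`. -/
def theta (t x : ℝ) (z : ℂ) : ℂ := z * x + 2 * z ^ 2 * t

/-! ### Scattering data of a decaying potential on the line -/

/-- `ψ` is the first column `ψ₋⁽¹⁾(t, ·, z)` of the Jost solution normalised at `x = -∞`. For
`Im z > 0` (and for real `z`) it is unique if it exists. -/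
def IsLeftJost (u : ℝ → ℝ → ℂ) (t : ℝ) (z : ℂ) (ψ : ℝ → Fin 2 → ℂ) : Prop :=
  (∀ x, HasDerivAt ψ (laxU z (u t x) *ᵥ ψ x) x) ∧
    Tendsto (fun x => Complex.exp (Complex.I * theta t x z) • ψ x) atBot (𝓝 ![1, 0])

/-- `ψ` is the second column `ψ₊⁽²⁾(t, ·, z)` of the Jost solution normalised at `x = +∞`. For
`Im z > 0` (and for real `z`) it is unique if it exists. -/
def IsRightJost (u : ℝ → ℝ → ℂ) (t : ℝ) (z : ℂ) (ψ : ℝ → Fin 2 → ℂ) : Prop :=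
  (∀ x, HasDerivAt ψ (laxU z (u t x) *ᵥ ψ x) x) ∧
    Tendsto (fun x => Complex.exp (-(Complex.I * theta t x z)) • ψ x) atTop (𝓝 ![0, 1])

/-- `c` is the weight of the potential `u` at the point `ζ` of the upper half plane: the function
`a₁₁ = det [ψ₋⁽¹⁾ | ψ₊⁽²⁾]`, which depends neither on `t` nor on `x`, has a simple zero at `ζ`, there
`ψ₋⁽¹⁾ = b ψ₊⁽²⁾` with a constant `b`, and `c = b / a₁₁'(ζ)`. -/
def IsWeight (u : ℝ → ℝ → ℂ) (ζ c : ℂ) : Prop :=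
  0 < ζ.im ∧
  ∃ (ψl ψr : ℝ → ℂ → ℝ → Fin 2 → ℂ) (a : ℂ → ℂ) (a' b : ℂ),
    (∀ t z, 0 < z.im → IsLeftJost u t z (ψl t z)) ∧
    (∀ t z, 0 < z.im → IsRightJost u t z (ψr t z)) ∧
    (∀ t x z, 0 < z.im →
      a z = det !![ψl t z x 0, ψr t z x 0; ψl t z x 1, ψr t z x 1]) ∧
    a ζ = 0 ∧ HasDerivAt a a' ζ ∧ a' ≠ 0 ∧
    (∀ t x, ψl t ζ x = b • ψr t ζ x) ∧
    c = b / a'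

/-- The position parameter of a soliton with spectral parameter `ξ + i η` and weight `c`. -/
def position (η : ℝ) (c : ℂ) : ℝ := 1 / (2 * η) * Real.log (‖c‖ / (2 * η))

/-- The phase parameter of a soliton with weight `c` (principal value; phases are meaningful
modulo `2π`). -/
def phase (c : ℂ) : ℝ := Complex.arg c

/-! ### The Darboux transformation -/

/-- The orthogonal projector `v v† / (v† v)` onto the line spanned by `v`. -/
def lineProjector (v : Fin 2 → ℂ) : Matrix (Fin 2) (Fin 2) ℂ :=
  (star v ⬝ᵥ v)⁻¹ • vecMulVec v (star v)

/-- The `M`-fold dressing matrix `D[M](t, x, z)` built from spectral parameters `μ` and vector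
functions `Ψ`: the product, with the last factor on the left, of the matrices
`(z - μⱼ*) + (μⱼ* - μⱼ) P[j]`, where `P[j]` projects onto `D[j-1](t, x, μⱼ) Ψⱼ(t, x)`. -/
def dressing : (M : ℕ) → (Fin M → ℂ) → (Fin M → ℝ → ℝ → Fin 2 → ℂ) →
    ℝ → ℝ → ℂ → Matrix (Fin 2) (Fin 2) ℂ
  | 0, _, _ => fun _ _ _ => 1
  | M + 1, μ, Ψ => fun t x z =>
    let m := μ (Fin.last M)
    let D := dressing M (fun j => μ j.castSucc) (fun j => Ψ j.castSucc) t x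
    ((z - conj m) • (1 : Matrix (Fin 2) (Fin 2) ℂ) +
      (conj m - m) • lineProjector (D m *ᵥ Ψ (Fin.last M) t x)) * D z

/-- The `M`-fold dressed potential
`Q[M] = Q[0] - i ∑ⱼ (μⱼ - μⱼ*) [σ₃, P[j]]`, with seed `u₀`. -/
def dressedPotential (u₀ : ℝ → ℝ → ℂ) : (M : ℕ) → (Fin M → ℂ) →
    (Fin M → ℝ → ℝ → Fin 2 → ℂ) → ℝ → ℝ → Matrix (Fin 2) (Fin 2) ℂ
  | 0, _, _ => fun t x => potential (u₀ t x)
  | M + 1, μ, Ψ => fun t x =>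
    let m := μ (Fin.last M)
    let μ' : Fin M → ℂ := fun j => μ j.castSucc
    let Ψ' : Fin M → ℝ → ℝ → Fin 2 → ℂ := fun j => Ψ j.castSucc
    let P := lineProjector (dressing M μ' Ψ' t x m *ᵥ Ψ (Fin.last M) t x)
    dressedPotential u₀ M μ' Ψ' t x -
      (Complex.I * (m - conj m)) • (sigmaThree * P - P * sigmaThree)

/-- The `M`-fold dressed solution `u[M]`. -/
def dressedSolution (u₀ : ℝ → ℝ → ℂ) (M : ℕ) (μ : Fin M → ℂ)
    (Ψ : Fin M → ℝ → ℝ → Fin 2 → ℂ) (t x : ℝ) : ℂ :=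
  dressedPotential u₀ M μ Ψ t x 0 1

/-! ### The zero seed and the boundary matrix -/

/-- The solution `e^{-i θ(t, x, z) σ₃} (p, q)ᵀ` of the Lax system with zero potential. -/
def zeroSeedSolution (z p q : ℂ) (t x : ℝ) : Fin 2 → ℂ :=
  ![Complex.exp (-(Complex.I * theta t x z)) * p, Complex.exp (Complex.I * theta t x z) * q]

/-- The vector `(-v₂*, v₁*)` orthogonal to `(v₁, v₂)`. -/
def orthVec (v : Fin 2 → ℂ) : Fin 2 → ℂ := ![-conj (v 1), conj (v 0)]

/-- The boundary matrix `K₀` with parameters `α`, `β` at spectral parameter `z`, where `w` is the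
boundary value of the solution and `Ω = √(β² - |w|²)`. -/
def boundaryMatrix (α β : ℝ) (w z : ℂ) : Matrix (Fin 2) (Fin 2) ℂ :=
  let Ω : ℂ := (Real.sqrt (β ^ 2 - ‖w‖ ^ 2) : ℝ)
  ((2 * z - Complex.I * (|β| : ℝ)) ^ 2 - (α : ℂ) ^ 2)⁻¹ •
    !![4 * z ^ 2 + 4 * Complex.I * z * Ω - ((α : ℂ) ^ 2 + (β : ℂ) ^ 2), 4 * Complex.I * z * w;
       4 * Complex.I * z * conj w, 4 * z ^ 2 - 4 * Complex.I * z * Ω - ((α : ℂ) ^ 2 + (β : ℂ) ^ 2)]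

/-- The solution `u[2N]` obtained from the zero seed by the `2N`-fold Darboux transformation with
the spectral parameters `z₁, …, z_N, (-z₁)*, …, (-z_N)*` and the vector functions `ψ₁, …, ψ_N` and
the orthogonal vectors of `ψ̂₁, …, ψ̂_N`, where `ψⱼ` and `ψ̂ⱼ` are the zero seed solutions at `zⱼ`
and `-zⱼ` with coefficients `(p, q)` and `(p̂, q̂)`. -/
def pairedSolution (N : ℕ) (z p q ph qh : Fin N → ℂ) : ℝ → ℝ → ℂ :=
  dressedSolution (fun _ _ => 0) (N + N)
    (Fin.append z (fun j => conj (-z j)))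
    (Fin.append (fun j => zeroSeedSolution (z j) (p j) (q j))
      (fun j t x => orthVec (zeroSeedSolution (-z j) (ph j) (qh j) t x)))

end NLSDressing

end

open NLSDressing

namespace NLSDressing

/-! ### Uniqueness of Jost solutions and of weights -/

/-! The dressing matrix carries solutions of the zero-potential system to solutions of the dressed
one (`hasDerivAt_dressing_mulVec`). As `x → ±∞` every `zeroSeedSolution` aligns with a coordinate
axis, so the dressing matrix becomes diagonal (`tendsto_dressing`). Hence the Jost solutions are the
dressed exponentials divided by `∏ (z - μⱼ*)`, and `a₁₁` is the Blaschke product `∏ (z - μⱼ) / (z -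
μⱼ*)`. At `μⱼ` the dressing matrix annihilates `Ψⱼ`, which forces `b = -qⱼ / pⱼ`; dividing by `a₁₁'`
gives the weight (`isWeight_solitonSolution`). It is the only one, because Jost solutions are unique
(`IsWeight.unique`).

In the paired case the spectrum is invariant under `λ ↦ -λ*`, so the Blaschke factors in the second
weight are the conjugates of those in the first (`isWeight_pairedSolution`), and `C Ĉ*` contains
their square. The coefficients enter `C Ĉ*` only through `(q / p) (p̂ / q̂)`. At boundary value zero
the boundary matrix is `diag (r, 1)` with an explicit `r`, so this quantity is `r` and the free
constants cancel. Positions and phases follow from the modulus and the argument of the product. -/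

lemma laxU_mulVec (z w : ℂ) (v : Fin 2 → ℂ) :
    laxU z w *ᵥ v = ![-(Complex.I * z) * v 0 + w * v 1, -conj w * v 0 + Complex.I * z * v 1] := by
  ext i
  fin_cases i <;> simp [laxU, sigmaThree, potential, Matrix.mulVec, dotProduct, Fin.sum_univ_two]

lemma hasDerivAt_exp_theta (c : ℂ) (t : ℝ) (z : ℂ) (x : ℝ) :
    HasDerivAt (fun x : ℝ => Complex.exp (c * theta t x z))
      (Complex.exp (c * theta t x z) * (c * z)) x := by
  have h : HasDerivAt (fun x : ℝ => c * theta t x z) (c * z) x := by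
    have := (((Complex.ofRealCLM.hasDerivAt (x := x)).const_mul z).add_const
      (2 * z ^ 2 * (t : ℂ))).const_mul c
    simpa [theta] using this
  exact h.cexp

lemma hasDerivAt_normSq {f : ℝ → ℂ} {f' : ℂ} {x : ℝ} (h : HasDerivAt f f' x) :
    HasDerivAt (fun x => Complex.normSq (f x)) (2 * (conj (f x) * f').re) x := by
  have hr : HasDerivAt (fun x => (f x).re) f'.re x := by
    exact Complex.reCLM.hasFDerivAt.comp_hasDerivAt x h
  have hi : HasDerivAt (fun x => (f x).im) f'.im x := by
    exact Complex.imCLM.hasFDerivAt.comp_hasDerivAt x h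
  have := (hr.mul hr).add (hi.mul hi)
  refine (this.congr_deriv ?_)
  simp
  ring

/-- A solution of the `x` part of the Lax pair, multiplied by `exp (s θ)`. -/
lemma hasDerivAt_exp_smul {z w s : ℂ} {t x : ℝ} {ψ : ℝ → Fin 2 → ℂ}
    (h : HasDerivAt ψ (laxU z w *ᵥ ψ x) x) :
    HasDerivAt (fun x => Complex.exp (s * theta t x z) • ψ x)
      (laxU z w *ᵥ (Complex.exp (s * theta t x z) • ψ x) +
        (s * z) • Complex.exp (s * theta t x z) • ψ x) x := by
  refine ((hasDerivAt_exp_theta s t z x).smul h).congr_deriv ?_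
  rw [Matrix.mulVec_smul, smul_smul, mul_comm (s * z)]

/-- The potential is skew-Hermitian, so its contribution to the derivative of the squared norm
cancels and only the diagonal terms remain. For `s = ±I` one of the two coefficients vanishes and
the other has a fixed sign when `0 ≤ z.im`. -/
lemma hasDerivAt_normSq_add {g : ℝ → Fin 2 → ℂ} {z w s : ℂ} {x : ℝ}
    (h : HasDerivAt g (laxU z w *ᵥ g x + (s * z) • g x) x) :
    HasDerivAt (fun x => Complex.normSq (g x 0) + Complex.normSq (g x 1))
      (2 * ((s * z).re + z.im) * Complex.normSq (g x 0) +
        2 * ((s * z).re - z.im) * Complex.normSq (g x 1)) x := by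
  rw [hasDerivAt_pi, laxU_mulVec] at h
  refine ((hasDerivAt_normSq (h 0)).add (hasDerivAt_normSq (h 1))).congr_deriv ?_
  simp [Complex.normSq_apply]
  ring

lemma tendsto_normSq_add {l : Filter ℝ} {g : ℝ → Fin 2 → ℂ} (h : Tendsto g l (𝓝 0)) :
    Tendsto (fun x => Complex.normSq (g x 0) + Complex.normSq (g x 1)) l (𝓝 0) := by
  rw [tendsto_pi_nhds] at h
  have h0 := (Complex.continuous_normSq.tendsto 0).comp (h 0)
  have h1 := (Complex.continuous_normSq.tendsto 0).comp (h 1)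
  simpa using h0.add h1

lemma eq_zero_of_normSq_add_nonpos {v : Fin 2 → ℂ}
    (h : Complex.normSq (v 0) + Complex.normSq (v 1) ≤ 0) : v = 0 := by
  have h0 := Complex.normSq_nonneg (v 0)
  have h1 := Complex.normSq_nonneg (v 1)
  have e0 : v 0 = 0 := Complex.normSq_eq_zero.1 (by linarith)
  have e1 : v 1 = 0 := Complex.normSq_eq_zero.1 (by linarith)
  ext i
  fin_cases i <;> simp [e0, e1]

/-- The difference of two solutions, multiplied by `exp (iθ)`, has nonincreasing squared norm and
tends to zero at `-∞`; hence it vanishes. No decay of `u` is needed. -/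
lemma IsLeftJost.unique {u : ℝ → ℝ → ℂ} {t : ℝ} {z : ℂ} (hz : 0 ≤ z.im) {ψ φ : ℝ → Fin 2 → ℂ}
    (hψ : IsLeftJost u t z ψ) (hφ : IsLeftJost u t z φ) : ψ = φ := by
  have hd : ∀ x, HasDerivAt (fun x => ψ x - φ x) (laxU z (u t x) *ᵥ (ψ x - φ x)) x := fun x => by
    rw [Matrix.mulVec_sub]
    exact (hψ.1 x).sub (hφ.1 x)
  have hg := fun x => hasDerivAt_normSq_add (hasDerivAt_exp_smul (s := Complex.I) (t := t) (hd x))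
  have hanti := antitone_of_hasDerivAt_nonpos hg (fun x => by
    have := Complex.normSq_nonneg ((Complex.exp (Complex.I * theta t x z) • (ψ x - φ x)) 1)
    simp only [Complex.mul_re, Complex.I_re, Complex.I_im, Pi.zero_apply]
    nlinarith)
  have hlim : Tendsto (fun x => Complex.exp (Complex.I * theta t x z) • (ψ x - φ x)) atBot
      (𝓝 0) := by
    simpa [smul_sub] using hψ.2.sub hφ.2
  funext x
  have h := eq_zero_of_normSq_add_nonpos (hanti.ge_of_tendsto (tendsto_normSq_add hlim) x)
  exact sub_eq_zero.1 ((smul_eq_zero.1 h).resolve_left (Complex.exp_ne_zero _))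

lemma IsRightJost.unique {u : ℝ → ℝ → ℂ} {t : ℝ} {z : ℂ} (hz : 0 ≤ z.im) {ψ φ : ℝ → Fin 2 → ℂ}
    (hψ : IsRightJost u t z ψ) (hφ : IsRightJost u t z φ) : ψ = φ := by
  have hd : ∀ x, HasDerivAt (fun x => ψ x - φ x) (laxU z (u t x) *ᵥ (ψ x - φ x)) x := fun x => by
    rw [Matrix.mulVec_sub]
    exact (hψ.1 x).sub (hφ.1 x)
  have hg := fun x => hasDerivAt_normSq_add (hasDerivAt_exp_smul (s := -Complex.I) (t := t) (hd x))
  have hmono := monotone_of_hasDerivAt_nonneg hg (fun x => by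
    have := Complex.normSq_nonneg ((Complex.exp (-Complex.I * theta t x z) • (ψ x - φ x)) 0)
    simp only [Complex.mul_re, Complex.neg_re, Complex.neg_im, Complex.I_re, Complex.I_im,
      Pi.zero_apply]
    nlinarith)
  have hlim : Tendsto (fun x => Complex.exp (-Complex.I * theta t x z) • (ψ x - φ x)) atTop
      (𝓝 0) := by
    simpa [smul_sub] using hψ.2.sub hφ.2
  funext x
  have h := eq_zero_of_normSq_add_nonpos (hmono.ge_of_tendsto (tendsto_normSq_add hlim) x)
  exact sub_eq_zero.1 ((smul_eq_zero.1 h).resolve_left (Complex.exp_ne_zero _))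

lemma IsRightJost.exists_ne_zero {u : ℝ → ℝ → ℂ} {t : ℝ} {z : ℂ} {ψ : ℝ → Fin 2 → ℂ}
    (hψ : IsRightJost u t z ψ) : ∃ x, ψ x ≠ 0 := by
  by_contra! h
  have h1 := (tendsto_pi_nhds.1 hψ.2) 1
  simp only [h, smul_zero, Pi.zero_apply] at h1
  simpa using tendsto_nhds_unique h1 tendsto_const_nhds

/-- Uniqueness of Jost solutions on the whole open half plane makes the two functions `a₁₁` agree
near `ζ`, hence also their derivatives. The constant `b` is then fixed at a point where the right
Jost solution does not vanish. -/
lemma IsWeight.unique {u : ℝ → ℝ → ℂ} {ζ c d : ℂ} (hc : IsWeight u ζ c) (hd : IsWeight u ζ d) :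
    c = d := by
  obtain ⟨hζ, ψl, ψr, a, a', b, hl, hr, ha, -, ha', -, hb, rfl⟩ := hc
  obtain ⟨-, φl, φr, e, e', f, hl₂, hr₂, he, -, he', -, hf, rfl⟩ := hd
  have hψl : ∀ t z, 0 < z.im → ψl t z = φl t z := fun t z h => (hl t z h).unique h.le (hl₂ t z h)
  have hψr : ∀ t z, 0 < z.im → ψr t z = φr t z := fun t z h => (hr t z h).unique h.le (hr₂ t z h)
  have hae : a =ᶠ[𝓝 ζ] e := by
    filter_upwards [(isOpen_lt continuous_const Complex.continuous_im).mem_nhds hζ] with z hz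
    rw [ha 0 0 z hz, he 0 0 z hz, hψl 0 z hz, hψr 0 z hz]
  have hderiv : a' = e' := ha'.unique (he'.congr_of_eventuallyEq hae)
  obtain ⟨x, hx⟩ := (hr 0 ζ hζ).exists_ne_zero
  have hbf : b = f := by
    have h := hb 0 x
    rw [hψl 0 ζ hζ, hf 0 x, ← hψr 0 ζ hζ] at h
    exact (smul_left_injective ℂ hx h).symm
  rw [hderiv, hbf]

/-! ### The dressing matrix -/

lemma lineProjector_eq (v : Fin 2 → ℂ) :
    lineProjector v = (conj (v 0) * v 0 + conj (v 1) * v 1)⁻¹ •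
      !![v 0 * conj (v 0), v 0 * conj (v 1); v 1 * conj (v 0), v 1 * conj (v 1)] := by
  ext i j
  fin_cases i <;> fin_cases j <;>
    simp [lineProjector, dotProduct, Fin.sum_univ_two, vecMulVec_apply]

lemma conj_mul_self_add_ne_zero {v : Fin 2 → ℂ} (h : v ≠ 0) :
    conj (v 0) * v 0 + conj (v 1) * v 1 ≠ 0 := by
  intro h0
  apply h
  apply eq_zero_of_normSq_add_nonpos
  rw [← Complex.normSq_eq_conj_mul_self, ← Complex.normSq_eq_conj_mul_self] at h0
  exact le_of_eq (by exact_mod_cast h0)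

/-- One factor `(z - m*) + (m* - m) P` of the dressing matrix, `P` projecting onto `v`. -/
noncomputable def dressingFactor (m z : ℂ) (v : Fin 2 → ℂ) : Matrix (Fin 2) (Fin 2) ℂ :=
  (z - conj m) • (1 : Matrix (Fin 2) (Fin 2) ℂ) + (conj m - m) • lineProjector v

lemma dressingFactor_mulVec (m z : ℂ) (v φ : Fin 2 → ℂ) (i : Fin 2) :
    (dressingFactor m z v *ᵥ φ) i = (z - conj m) * φ i + (conj m - m) *
      ((conj (v 0) * φ 0 + conj (v 1) * φ 1) / (conj (v 0) * v 0 + conj (v 1) * v 1) * v i) := by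
  fin_cases i <;>
    simp [dressingFactor, lineProjector_eq, Matrix.mulVec, dotProduct, Fin.sum_univ_two] <;> ring

lemma dressingFactor_mulVec_self {m : ℂ} {v : Fin 2 → ℂ} (h : v ≠ 0) :
    dressingFactor m m v *ᵥ v = 0 := by
  ext i
  rw [dressingFactor_mulVec, div_self (conj_mul_self_add_ne_zero h)]
  simp only [Pi.zero_apply]
  ring

/-- The factor acts as `z - m` on `v` and as `z - m*` on its orthogonal complement. -/
lemma det_dressingFactor (m z : ℂ) {v : Fin 2 → ℂ} (h : v ≠ 0) :
    (dressingFactor m z v).det = (z - m) * (z - conj m) := by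
  have hn := conj_mul_self_add_ne_zero h
  simp only [dressingFactor, lineProjector_eq, det_fin_two]
  simp
  field_simp
  ring

/-- One Darboux step, checked by differentiating the components. The new potential is the upper
right entry of `Q - i (m - m*) [σ₃, P]`. -/
lemma hasDerivAt_dressingFactor_mulVec {v φ : ℝ → Fin 2 → ℂ} {m z w : ℂ} {x : ℝ}
    (hv : HasDerivAt v (laxU m w *ᵥ v x) x) (hφ : HasDerivAt φ (laxU z w *ᵥ φ x) x)
    (h0 : v x ≠ 0) :
    HasDerivAt (fun x => dressingFactor m z (v x) *ᵥ φ x)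
      (laxU z (w - 2 * Complex.I * (m - conj m) * lineProjector (v x) 0 1) *ᵥ
        (dressingFactor m z (v x) *ᵥ φ x)) x := by
  have hn := conj_mul_self_add_ne_zero h0
  rw [laxU_mulVec, hasDerivAt_pi] at hv hφ
  have v0 := hv 0
  have v1 := hv 1
  have p0 := hφ 0
  have p1 := hφ 1
  have c0 := v0.star
  have c1 := v1.star
  simp only [Matrix.cons_val_zero, Matrix.cons_val_one] at v0 v1 p0 p1 c0 c1
  -- Derivative of the quotient `v†φ / v†v`, the only nonlinear ingredient of `P φ`.
  have hq := ((c0.mul p0).add (c1.mul p1)).div ((c0.mul v0).add (c1.mul v1)) hn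
  rw [laxU_mulVec, hasDerivAt_pi]
  intro i
  simp only [dressingFactor_mulVec, lineProjector_eq]
  fin_cases i
  · refine ((p0.const_mul (z - conj m)).add ((hq.mul v0).const_mul (conj m - m))).congr_deriv ?_
    simp [Complex.conj_ofNat]
    field_simp
    ring
  · refine ((p1.const_mul (z - conj m)).add ((hq.mul v1).const_mul (conj m - m))).congr_deriv ?_
    simp [Complex.conj_ofNat]
    field_simp
    ring

lemma dressing_succ (M : ℕ) (μ : Fin (M + 1) → ℂ) (Ψ : Fin (M + 1) → ℝ → ℝ → Fin 2 → ℂ)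
    (t x : ℝ) (z : ℂ) :
    dressing (M + 1) μ Ψ t x z = dressingFactor (μ (Fin.last M)) z
      (dressing M (fun j => μ j.castSucc) (fun j => Ψ j.castSucc) t x (μ (Fin.last M)) *ᵥ
        Ψ (Fin.last M) t x) *
      dressing M (fun j => μ j.castSucc) (fun j => Ψ j.castSucc) t x z := rfl

lemma commutator_sigmaThree (P : Matrix (Fin 2) (Fin 2) ℂ) :
    sigmaThree * P - P * sigmaThree = !![0, 2 * P 0 1; -(2 * P 1 0), 0] := by
  rw [Matrix.eta_fin_two P, sigmaThree, Matrix.mul_fin_two, Matrix.mul_fin_two]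
  ext i j
  fin_cases i <;> fin_cases j <;> simp <;> ring

lemma dressedSolution_succ (u₀ : ℝ → ℝ → ℂ) (M : ℕ) (μ : Fin (M + 1) → ℂ)
    (Ψ : Fin (M + 1) → ℝ → ℝ → Fin 2 → ℂ) (t x : ℝ) :
    dressedSolution u₀ (M + 1) μ Ψ t x =
      dressedSolution u₀ M (fun j => μ j.castSucc) (fun j => Ψ j.castSucc) t x -
      2 * Complex.I * (μ (Fin.last M) - conj (μ (Fin.last M))) * lineProjector
        (dressing M (fun j => μ j.castSucc) (fun j => Ψ j.castSucc) t x (μ (Fin.last M)) *ᵥ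
          Ψ (Fin.last M) t x) 0 1 := by
  simp only [dressedSolution, dressedPotential, commutator_sigmaThree, Matrix.sub_apply,
    Matrix.smul_apply, smul_eq_mul, Matrix.of_apply, Matrix.cons_val_zero, Matrix.cons_val_one]
  ring

lemma injective_comp_castSucc {M : ℕ} {μ : Fin (M + 1) → ℂ} (h : Function.Injective μ) :
    Function.Injective (fun j : Fin M => μ j.castSucc) :=
  h.comp (Fin.castSucc_injective M)

lemma prod_sub_mul_sub_conj_ne_zero {M : ℕ} {μ : Fin (M + 1) → ℂ} (hinj : Function.Injective μ)
    (him : ∀ j, 0 < (μ j).im) :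
    ∏ j : Fin M, ((μ (Fin.last M) - μ j.castSucc) * (μ (Fin.last M) - conj (μ j.castSucc))) ≠ 0 := by
  refine Finset.prod_ne_zero_iff.2 fun j _ => mul_ne_zero ?_ ?_
  · exact sub_ne_zero.2 fun h => (Fin.castSucc_lt_last j).ne' (hinj h)
  · intro h
    have := congrArg Complex.im h
    simp at this
    linarith [him (Fin.last M), him j.castSucc]

/-- The last factor has the expected determinant only if the vector it projects onto is nonzero. The
induction hypothesis provides this: the previous dressing matrix is invertible at the new, distinct
parameter. -/
lemma det_dressing {M : ℕ} {μ : Fin M → ℂ} (hinj : Function.Injective μ)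
    (him : ∀ j, 0 < (μ j).im) {Ψ : Fin M → ℝ → ℝ → Fin 2 → ℂ} {t x : ℝ}
    (hΨ : ∀ j, Ψ j t x ≠ 0) (z : ℂ) :
    (dressing M μ Ψ t x z).det = ∏ j, ((z - μ j) * (z - conj (μ j))) := by
  induction M generalizing z with
  | zero => simp [dressing]
  | succ M ih =>
    have h := fun z => ih (injective_comp_castSucc hinj) (fun j => him j.castSucc)
      (fun j => hΨ j.castSucc) z
    rw [dressing_succ, det_mul, h, Fin.prod_univ_castSucc, det_dressingFactor, mul_comm]
    intro h0
    refine hΨ (Fin.last M) (Matrix.eq_zero_of_mulVec_eq_zero ?_ h0)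
    rw [h]
    exact prod_sub_mul_sub_conj_ne_zero hinj him

lemma dressing_mulVec_ne_zero {M : ℕ} {μ : Fin (M + 1) → ℂ} (hinj : Function.Injective μ)
    (him : ∀ j, 0 < (μ j).im) {Ψ : Fin (M + 1) → ℝ → ℝ → Fin 2 → ℂ} {t x : ℝ}
    (hΨ : ∀ j, Ψ j t x ≠ 0) :
    dressing M (fun j => μ j.castSucc) (fun j => Ψ j.castSucc) t x (μ (Fin.last M)) *ᵥ
      Ψ (Fin.last M) t x ≠ 0 := by
  intro h0
  refine hΨ (Fin.last M) (Matrix.eq_zero_of_mulVec_eq_zero ?_ h0)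
  rw [det_dressing (injective_comp_castSucc hinj) (fun j => him j.castSucc)
    (fun j => hΨ j.castSucc)]
  exact prod_sub_mul_sub_conj_ne_zero hinj him

/-- The dressing matrix at a spectral parameter annihilates the corresponding solution. -/
lemma dressing_mulVec_self {M : ℕ} {μ : Fin M → ℂ} (hinj : Function.Injective μ)
    (him : ∀ j, 0 < (μ j).im) {Ψ : Fin M → ℝ → ℝ → Fin 2 → ℂ} {t x : ℝ}
    (hΨ : ∀ j, Ψ j t x ≠ 0) (j : Fin M) :
    dressing M μ Ψ t x (μ j) *ᵥ Ψ j t x = 0 := by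
  induction M with
  | zero => exact j.elim0
  | succ M ih =>
    rw [dressing_succ, ← Matrix.mulVec_mulVec]
    refine Fin.lastCases ?_ (fun i => ?_) j
    · exact dressingFactor_mulVec_self (dressing_mulVec_ne_zero hinj him hΨ)
    · rw [ih (injective_comp_castSucc hinj) (fun j => him j.castSucc) (fun j => hΨ j.castSucc) i,
        Matrix.mulVec_zero]

/-- The dressing matrix maps solutions with potential `u₀` to solutions with the dressed
potential. -/
lemma hasDerivAt_dressing_mulVec {u₀ : ℝ → ℝ → ℂ} {M : ℕ} {μ : Fin M → ℂ}
    (hinj : Function.Injective μ) (him : ∀ j, 0 < (μ j).im)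
    {Ψ : Fin M → ℝ → ℝ → Fin 2 → ℂ} {t x : ℝ} (hΨ : ∀ j, Ψ j t x ≠ 0)
    (hd : ∀ j, HasDerivAt (Ψ j t) (laxU (μ j) (u₀ t x) *ᵥ Ψ j t x) x)
    {z : ℂ} {φ : ℝ → Fin 2 → ℂ} (hφ : HasDerivAt φ (laxU z (u₀ t x) *ᵥ φ x) x) :
    HasDerivAt (fun x => dressing M μ Ψ t x z *ᵥ φ x)
      (laxU z (dressedSolution u₀ M μ Ψ t x) *ᵥ (dressing M μ Ψ t x z *ᵥ φ x)) x := by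
  induction M generalizing z φ with
  | zero => simpa [dressing, dressedSolution, dressedPotential, potential] using hφ
  | succ M ih =>
    -- The induction hypothesis is needed twice: for `φ` at `z`, and for the last `Ψ` at its own
    -- spectral parameter.
    have h : ∀ {z : ℂ} {φ : ℝ → Fin 2 → ℂ} (_ : HasDerivAt φ (laxU z (u₀ t x) *ᵥ φ x) x), _ :=
      fun hφ => ih (injective_comp_castSucc hinj) (fun j => him j.castSucc)
        (fun j => hΨ j.castSucc) (fun j => hd j.castSucc) hφ
    simp only [dressing_succ, ← Matrix.mulVec_mulVec, dressedSolution_succ]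
    exact hasDerivAt_dressingFactor_mulVec (h (hd (Fin.last M))) (h hφ)
      (dressing_mulVec_ne_zero hinj him hΨ)

/-! ### Asymptotics of the dressing matrix -/

lemma lineProjector_smul {c : ℂ} (hc : c ≠ 0) (v : Fin 2 → ℂ) :
    lineProjector (c • v) = lineProjector v := by
  have hc' : conj c ≠ 0 := (map_ne_zero _).2 hc
  have h : conj (c * v 0) * (c * v 0) + conj (c * v 1) * (c * v 1) =
      (conj c * c) * (conj (v 0) * v 0 + conj (v 1) * v 1) := by
    simp only [map_mul]
    ring
  ext i j
  fin_cases i <;> fin_cases j <;> simp [lineProjector_eq] <;> simp only [← map_mul, h] <;>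
    simp only [map_mul] <;> field_simp

lemma tendsto_lineProjector {l : Filter ℝ} {v : ℝ → Fin 2 → ℂ} {v₀ : Fin 2 → ℂ}
    (h : Tendsto v l (𝓝 v₀)) (h0 : v₀ ≠ 0) :
    Tendsto (fun x => lineProjector (v x)) l (𝓝 (lineProjector v₀)) := by
  have h1 : Continuous fun v : Fin 2 → ℂ => star v ⬝ᵥ v := by fun_prop
  have h2 : Continuous fun v : Fin 2 → ℂ => vecMulVec v (star v) := by fun_prop
  have h3 : star v₀ ⬝ᵥ v₀ ≠ 0 := by
    simpa [dotProduct, Fin.sum_univ_two] using conj_mul_self_add_ne_zero h0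
  exact (((h1.tendsto v₀).comp h).inv₀ h3).smul ((h2.tendsto v₀).comp h)

/-- The vectors themselves may grow; only their lines matter, so convergence after rescaling by `s`
suffices. -/
lemma tendsto_dressingFactor {l : Filter ℝ} {v : ℝ → Fin 2 → ℂ} {s : ℝ → ℂ} {v₀ : Fin 2 → ℂ}
    (hs : ∀ x, s x ≠ 0) (h : Tendsto (fun x => s x • v x) l (𝓝 v₀)) (h0 : v₀ ≠ 0) (m z : ℂ) :
    Tendsto (fun x => dressingFactor m z (v x)) l (𝓝 (dressingFactor m z v₀)) := by
  have hP := tendsto_lineProjector h h0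
  simp only [lineProjector_smul (hs _)] at hP
  exact tendsto_const_nhds.add (hP.const_smul (conj m - m))

lemma dressingFactor_single (m z c : ℂ) (hc : c ≠ 0) (i : Fin 2) :
    dressingFactor m z (Pi.single i c) =
      Matrix.diagonal (fun k => if k = i then z - m else z - conj m) := by
  have hc' : conj c ≠ 0 := (map_ne_zero _).2 hc
  ext k l
  fin_cases i <;> fin_cases k <;> fin_cases l <;>
    simp [dressingFactor, lineProjector_eq] <;> field_simp <;> ring

/-- If all `Ψⱼ` become parallel to the `i`-th basis vector, then the dressing matrix becomes
diagonal. -/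
lemma tendsto_dressing {M : ℕ} {μ : Fin M → ℂ} (hinj : Function.Injective μ)
    (him : ∀ j, 0 < (μ j).im) {Ψ : Fin M → ℝ → ℝ → Fin 2 → ℂ} {t : ℝ} {l : Filter ℝ}
    {i : Fin 2} {s : Fin M → ℝ → ℂ} (hs : ∀ j x, s j x ≠ 0) {c : Fin M → ℂ} (hc : ∀ j, c j ≠ 0)
    (hlim : ∀ j, Tendsto (fun x => s j x • Ψ j t x) l (𝓝 (Pi.single i (c j)))) (z : ℂ) :
    Tendsto (fun x => dressing M μ Ψ t x z) l (𝓝 (Matrix.diagonal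
      (fun k => if k = i then ∏ j, (z - μ j) else ∏ j, (z - conj (μ j))))) := by
  induction M generalizing z with
  | zero => simpa [dressing] using tendsto_const_nhds
  | succ M ih =>
    have h := fun z => ih (injective_comp_castSucc hinj) (fun j => him j.castSucc)
      (fun j => hs j.castSucc) (fun j => hc j.castSucc) (fun j => hlim j.castSucc) z
    set m := μ (Fin.last M) with hm
    -- The `i`-th component of the limit of the rescaled vector that the last factor projects onto;
    -- distinctness of the parameters keeps it nonzero.
    set c' := (∏ j : Fin M, (m - μ j.castSucc)) * c (Fin.last M) with hc'
    have hne : c' ≠ 0 := mul_ne_zero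
      (left_ne_zero_of_mul (by
        simpa [Finset.prod_mul_distrib] using prod_sub_mul_sub_conj_ne_zero hinj him))
      (hc _)
    have hv : Tendsto (fun x => s (Fin.last M) x • (dressing M (fun j => μ j.castSucc)
        (fun j => Ψ j.castSucc) t x m *ᵥ Ψ (Fin.last M) t x)) l (𝓝 (Pi.single i c')) := by
      have hcont : Continuous fun A : Matrix (Fin 2) (Fin 2) ℂ × (Fin 2 → ℂ) => A.1 *ᵥ A.2 := by
        fun_prop
      have := (hcont.tendsto _).comp ((h m).prodMk_nhds (hlim (Fin.last M)))
      have e : (Matrix.diagonal (fun k => if k = i then ∏ j : Fin M, (m - μ j.castSucc)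
          else ∏ j : Fin M, (m - conj (μ j.castSucc)))) *ᵥ
            (Pi.single i (c (Fin.last M)) : Fin 2 → ℂ) = Pi.single i c' := by
        ext k
        rw [Matrix.mulVec_diagonal]
        by_cases hk : k = i
        · subst hk; simp [hc']
        · simp [hk]
      simp only [e] at this
      simpa only [Matrix.mulVec_smul, Function.comp_def] using this
    have hne' : (Pi.single i c' : Fin 2 → ℂ) ≠ 0 := by simpa using hne
    have := (tendsto_dressingFactor (hs (Fin.last M)) hv hne' m z).mul (h z)
    simp only [dressing_succ, ← hm]
    convert this using 2
    rw [dressingFactor_single m z c' hne, Matrix.diagonal_mul_diagonal]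
    congr 1
    funext k
    simp only [Fin.prod_univ_castSucc]
    split_ifs <;> exact mul_comm _ _

/-! ### Scattering data of the dressed zero seed -/

lemma hasDerivAt_zeroSeedSolution (z p q : ℂ) (t x : ℝ) :
    HasDerivAt (zeroSeedSolution z p q t) (laxU z 0 *ᵥ zeroSeedSolution z p q t x) x := by
  rw [laxU_mulVec, hasDerivAt_pi]
  intro i
  fin_cases i
  · have h := (hasDerivAt_exp_theta (-Complex.I) t z x).mul_const p
    simp only [neg_mul] at h
    refine h.congr_deriv ?_
    simp [zeroSeedSolution]
    ring
  · refine ((hasDerivAt_exp_theta Complex.I t z x).mul_const q).congr_deriv ?_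
    simp [zeroSeedSolution]
    ring

lemma zeroSeedSolution_ne_zero {p : ℂ} (hp : p ≠ 0) (z q : ℂ) (t x : ℝ) :
    zeroSeedSolution z p q t x ≠ 0 := fun h => by
  have := congrFun h 0
  simp [zeroSeedSolution, hp] at this

lemma exp_smul_zeroSeedSolution (z p q : ℂ) (t x : ℝ) :
    Complex.exp (Complex.I * theta t x z) • zeroSeedSolution z p q t x =
      ![p, Complex.exp (2 * Complex.I * theta t x z) * q] := by
  ext i
  fin_cases i
  · simp [zeroSeedSolution, ← mul_assoc, ← Complex.exp_add]
  · simp only [zeroSeedSolution, Pi.smul_apply, smul_eq_mul]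
    simp [← mul_assoc, ← Complex.exp_add]
    left
    congr 1
    ring

lemma exp_neg_smul_zeroSeedSolution (z p q : ℂ) (t x : ℝ) :
    Complex.exp (-(Complex.I * theta t x z)) • zeroSeedSolution z p q t x =
      ![Complex.exp (-(2 * Complex.I * theta t x z)) * p, q] := by
  ext i
  fin_cases i
  · simp [zeroSeedSolution, ← mul_assoc, ← Complex.exp_add]
    left
    congr 1
    ring
  · simp [zeroSeedSolution, ← mul_assoc, ← Complex.exp_add]

lemma tendsto_exp_theta_atTop {z : ℂ} (hz : 0 < z.im) (t : ℝ) :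
    Tendsto (fun x => Complex.exp (2 * Complex.I * theta t x z)) atTop (𝓝 0) := by
  rw [Complex.tendsto_exp_nhds_zero_iff]
  have h : (fun x : ℝ => (2 * Complex.I * theta t x z).re) =
      fun x => -(2 * z.im) * x + (2 * Complex.I * (2 * z ^ 2 * t)).re := by
    funext x
    simp [theta, mul_add]
    ring
  rw [h]
  exact tendsto_atBot_add_const_right _ _
    ((tendsto_const_mul_atBot_of_neg (by linarith)).2 tendsto_id)

lemma tendsto_exp_neg_theta_atBot {z : ℂ} (hz : 0 < z.im) (t : ℝ) :
    Tendsto (fun x => Complex.exp (-(2 * Complex.I * theta t x z))) atBot (𝓝 0) := by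
  rw [Complex.tendsto_exp_nhds_zero_iff]
  have h : (fun x : ℝ => (-(2 * Complex.I * theta t x z)).re) =
      fun x => (2 * z.im) * x + (-(2 * Complex.I * (2 * z ^ 2 * t))).re := by
    funext x
    simp [theta, mul_add]
    ring
  rw [h]
  exact tendsto_atBot_add_const_right _ _
    ((tendsto_const_mul_atBot_of_pos (by linarith)).2 tendsto_id)

lemma tendsto_exp_smul_zeroSeedSolution_atTop {z : ℂ} (hz : 0 < z.im) (p q : ℂ) (t : ℝ) :
    Tendsto (fun x => Complex.exp (Complex.I * theta t x z) • zeroSeedSolution z p q t x) atTop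
      (𝓝 (Pi.single 0 p)) := by
  simp only [exp_smul_zeroSeedSolution]
  rw [tendsto_pi_nhds]
  intro i
  fin_cases i
  · simp
  · simpa using (tendsto_exp_theta_atTop hz t).mul_const q

lemma tendsto_exp_neg_smul_zeroSeedSolution_atBot {z : ℂ} (hz : 0 < z.im) (p q : ℂ) (t : ℝ) :
    Tendsto (fun x => Complex.exp (-(Complex.I * theta t x z)) • zeroSeedSolution z p q t x) atBot
      (𝓝 (Pi.single 1 q)) := by
  simp only [exp_neg_smul_zeroSeedSolution]
  rw [tendsto_pi_nhds]
  intro i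
  fin_cases i
  · simpa using (tendsto_exp_neg_theta_atBot hz t).mul_const p
  · simp

/-- The dressed zero seed at spectral parameters `μ` with coefficients `p` and `q`. -/
noncomputable def solitonSolution {M : ℕ} (μ p q : Fin M → ℂ) : ℝ → ℝ → ℂ :=
  dressedSolution (fun _ _ => 0) M μ (fun j => zeroSeedSolution (μ j) (p j) (q j))

/-- The image of the zero seed solution with coefficients `(r, s)` under the dressing matrix,
normalised by `∏ (z - μⱼ*)`. -/
noncomputable def dressedSeed {M : ℕ} (μ p q : Fin M → ℂ) (r s : ℂ) (t : ℝ) (z : ℂ) (x : ℝ) :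
    Fin 2 → ℂ :=
  (∏ j, (z - conj (μ j)))⁻¹ •
    (dressing M μ (fun j => zeroSeedSolution (μ j) (p j) (q j)) t x z *ᵥ zeroSeedSolution z r s t x)

section

variable {M : ℕ} {μ p q : Fin M → ℂ}

lemma prod_sub_conj_ne_zero (him : ∀ j, 0 < (μ j).im) {z : ℂ} (hz : 0 < z.im) :
    ∏ j, (z - conj (μ j)) ≠ 0 := by
  refine Finset.prod_ne_zero_iff.2 fun j _ h => ?_
  have := congrArg Complex.im h
  simp at this
  linarith [him j]

lemma hasDerivAt_dressedSeed (hinj : Function.Injective μ) (him : ∀ j, 0 < (μ j).im)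
    (hp : ∀ j, p j ≠ 0) (r s : ℂ) (t : ℝ) (z : ℂ) (x : ℝ) :
    HasDerivAt (dressedSeed μ p q r s t z)
      (laxU z (solitonSolution μ p q t x) *ᵥ dressedSeed μ p q r s t z x) x := by
  have h := hasDerivAt_dressing_mulVec (u₀ := fun _ _ => 0) hinj him
    (Ψ := fun j => zeroSeedSolution (μ j) (p j) (q j)) (t := t) (x := x)
    (fun j => zeroSeedSolution_ne_zero (hp j) _ _ _ _)
    (fun j => hasDerivAt_zeroSeedSolution _ _ _ _ _) (hasDerivAt_zeroSeedSolution z r s t x)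
  refine (h.const_smul (∏ j, (z - conj (μ j)))⁻¹).congr_deriv ?_
  rw [dressedSeed, Matrix.mulVec_smul]
  rfl

/-- At `-∞` the second component of each seed solution dominates, as `q j ≠ 0`. The upper left entry
of the dressing matrix therefore tends to `∏ (z - μⱼ*)`, which the normalisation divides out. -/
lemma isLeftJost_dressedSeed (hinj : Function.Injective μ) (him : ∀ j, 0 < (μ j).im)
    (hp : ∀ j, p j ≠ 0) (hq : ∀ j, q j ≠ 0) (t : ℝ) {z : ℂ} (hz : 0 < z.im) :
    IsLeftJost (solitonSolution μ p q) t z (dressedSeed μ p q 1 0 t z) := by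
  refine ⟨hasDerivAt_dressedSeed hinj him hp 1 0 t z, ?_⟩
  have hlim := tendsto_dressing hinj him (Ψ := fun j => zeroSeedSolution (μ j) (p j) (q j))
    (t := t) (l := atBot) (i := 1) (s := fun j x => Complex.exp (-(Complex.I * theta t x (μ j))))
    (fun _ _ => Complex.exp_ne_zero _) (c := q) hq
    (fun j => tendsto_exp_neg_smul_zeroSeedSolution_atBot (him j) _ _ _) z
  have hcont : Continuous fun A : Matrix (Fin 2) (Fin 2) ℂ =>
      (∏ j, (z - conj (μ j)))⁻¹ • (A *ᵥ ![(1 : ℂ), 0]) := by fun_prop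
  convert (hcont.tendsto _).comp hlim using 2
  · simp only [Function.comp_def, dressedSeed]
    rw [smul_comm, ← Matrix.mulVec_smul, exp_smul_zeroSeedSolution, mul_zero]
  · ext k
    fin_cases k <;> simp [prod_sub_conj_ne_zero him hz]

/-- The mirror image: at `+∞` the first component dominates, and the lower right entry has the same
limit `∏ (z - μⱼ*)`. -/
lemma isRightJost_dressedSeed (hinj : Function.Injective μ) (him : ∀ j, 0 < (μ j).im)
    (hp : ∀ j, p j ≠ 0) (t : ℝ) {z : ℂ} (hz : 0 < z.im) :
    IsRightJost (solitonSolution μ p q) t z (dressedSeed μ p q 0 1 t z) := by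
  refine ⟨hasDerivAt_dressedSeed hinj him hp 0 1 t z, ?_⟩
  have hlim := tendsto_dressing hinj him (Ψ := fun j => zeroSeedSolution (μ j) (p j) (q j))
    (t := t) (l := atTop) (i := 0) (s := fun j x => Complex.exp (Complex.I * theta t x (μ j)))
    (fun _ _ => Complex.exp_ne_zero _) (c := p) hp
    (fun j => tendsto_exp_smul_zeroSeedSolution_atTop (him j) _ _ _) z
  have hcont : Continuous fun A : Matrix (Fin 2) (Fin 2) ℂ =>
      (∏ j, (z - conj (μ j)))⁻¹ • (A *ᵥ ![(0 : ℂ), 1]) := by fun_prop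
  convert (hcont.tendsto _).comp hlim using 2
  · simp only [Function.comp_def, dressedSeed]
    rw [smul_comm, ← Matrix.mulVec_smul, exp_neg_smul_zeroSeedSolution, mul_zero]
  · ext k
    fin_cases k <;> simp [prod_sub_conj_ne_zero him hz]

lemma det_dressedSeed (hinj : Function.Injective μ) (him : ∀ j, 0 < (μ j).im)
    (hp : ∀ j, p j ≠ 0) (t x : ℝ) {z : ℂ} (hz : 0 < z.im) :
    det !![dressedSeed μ p q 1 0 t z x 0, dressedSeed μ p q 0 1 t z x 0;
      dressedSeed μ p q 1 0 t z x 1, dressedSeed μ p q 0 1 t z x 1] =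
      ∏ j, ((z - μ j) / (z - conj (μ j))) := by
  have h := det_dressing hinj him (Ψ := fun j => zeroSeedSolution (μ j) (p j) (q j))
    (t := t) (x := x) (fun j => zeroSeedSolution_ne_zero (hp j) _ _ _ _) z
  have he : Complex.exp (Complex.I * theta t x z) * Complex.exp (-(Complex.I * theta t x z)) = 1 := by
    rw [← Complex.exp_add]
    simp
  have hne := prod_sub_conj_ne_zero him hz
  rw [det_fin_two, Finset.prod_mul_distrib] at h
  rw [Finset.prod_div_distrib, det_fin_two_of]
  simp only [dressedSeed, Pi.smul_apply, smul_eq_mul, Matrix.mulVec, dotProduct, Fin.sum_univ_two,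
    zeroSeedSolution, Matrix.cons_val_zero, Matrix.cons_val_one, mul_one, mul_zero, add_zero,
    zero_add]
  field_simp
  linear_combination h + (dressing M μ (fun j => zeroSeedSolution (μ j) (p j) (q j)) t x z 0 0 *
    dressing M μ (fun j => zeroSeedSolution (μ j) (p j) (q j)) t x z 1 1 -
    dressing M μ (fun j => zeroSeedSolution (μ j) (p j) (q j)) t x z 0 1 *
    dressing M μ (fun j => zeroSeedSolution (μ j) (p j) (q j)) t x z 1 0) * he

/-- Split `Ψⱼ` into its two exponential components; since the dressing matrix annihilates `Ψⱼ` at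
`μⱼ`, their images are proportional, with a constant free of `t` and `x`. -/
lemma dressedSeed_eq_smul (hinj : Function.Injective μ) (him : ∀ j, 0 < (μ j).im)
    (hp : ∀ j, p j ≠ 0) (t x : ℝ) (j : Fin M) :
    dressedSeed μ p q 1 0 t (μ j) x = (-(q j / p j)) • dressedSeed μ p q 0 1 t (μ j) x := by
  have h := dressing_mulVec_self hinj him (Ψ := fun j => zeroSeedSolution (μ j) (p j) (q j))
    (t := t) (x := x) (fun j => zeroSeedSolution_ne_zero (hp j) _ _ _ _) j
  have hs : zeroSeedSolution (μ j) 1 0 t x = (p j)⁻¹ • zeroSeedSolution (μ j) (p j) (q j) t x +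
      (-(q j / p j)) • zeroSeedSolution (μ j) 0 1 t x := by
    have := hp j
    ext i
    fin_cases i <;> simp [zeroSeedSolution] <;> field_simp
    simp
  rw [dressedSeed, dressedSeed, hs, Matrix.mulVec_add, Matrix.mulVec_smul, Matrix.mulVec_smul, h,
    smul_zero, zero_add, smul_comm]

/-- Write the product as `(z - μⱼ) g(z)` with `g` differentiable at `μⱼ`; the derivative there is
`g(μⱼ)`. -/
lemma hasDerivAt_prod_div (him : ∀ j, 0 < (μ j).im) (j : Fin M) :
    HasDerivAt (fun z => ∏ k, ((z - μ k) / (z - conj (μ k))))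
      ((μ j - conj (μ j))⁻¹ *
        ∏ k ∈ Finset.univ.erase j, ((μ j - μ k) / (μ j - conj (μ k)))) (μ j) := by
  have hne : ∀ k, μ j - conj (μ k) ≠ 0 := fun k h => by
    have := congrArg Complex.im h
    simp at this
    linarith [him j, him k]
  have hd : DifferentiableAt ℂ (fun z => (z - conj (μ j))⁻¹ *
      ∏ k ∈ Finset.univ.erase j, ((z - μ k) / (z - conj (μ k)))) (μ j) := by
    refine DifferentiableAt.mul ?_ (DifferentiableAt.fun_finsetProd fun k _ => ?_)
    · exact DifferentiableAt.inv (by fun_prop) (hne j)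
    · exact DifferentiableAt.div (by fun_prop) (by fun_prop) (hne k)
  have h := ((hasDerivAt_id (μ j)).sub_const (μ j)).mul hd.hasDerivAt
  simp only [id, sub_self, zero_mul, add_zero, one_mul] at h
  refine h.congr_of_eventuallyEq (Eventually.of_forall fun z => ?_)
  dsimp only
  rw [← Finset.mul_prod_erase _ _ (Finset.mem_univ j)]
  simp only [Pi.mul_apply]
  ring

/-- The weights of the dressed zero seed. -/
lemma isWeight_solitonSolution (hinj : Function.Injective μ) (him : ∀ j, 0 < (μ j).im)
    (hp : ∀ j, p j ≠ 0) (hq : ∀ j, q j ≠ 0) (j : Fin M) :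
    IsWeight (solitonSolution μ p q) (μ j) (-(q j / p j) * (μ j - conj (μ j)) *
      ∏ k ∈ Finset.univ.erase j, ((μ j - conj (μ k)) / (μ j - μ k))) := by
  have hne : ∀ k, μ j - conj (μ k) ≠ 0 := fun k h => by
    have := congrArg Complex.im h
    simp at this
    linarith [him j, him k]
  refine ⟨him j, dressedSeed μ p q 1 0, dressedSeed μ p q 0 1,
    fun z => ∏ k, ((z - μ k) / (z - conj (μ k))), _, _,
    fun t z hz => isLeftJost_dressedSeed hinj him hp hq t hz,
    fun t z hz => isRightJost_dressedSeed hinj him hp t hz,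
    fun t x z hz => (det_dressedSeed hinj him hp t x hz).symm,
    Finset.prod_eq_zero (Finset.mem_univ j) (by simp), hasDerivAt_prod_div him j, ?_,
    fun t x => dressedSeed_eq_smul hinj him hp t x j, ?_⟩
  · refine mul_ne_zero (inv_ne_zero (hne j)) (Finset.prod_ne_zero_iff.2 fun k hk => ?_)
    exact div_ne_zero (sub_ne_zero.2 fun h => Finset.ne_of_mem_erase hk (hinj h).symm) (hne k)
  · rw [div_eq_mul_inv _ ((μ j - conj (μ j))⁻¹ * _), mul_inv, inv_inv, ← Finset.prod_inv_distrib]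
    simp only [inv_div, mul_assoc]

end

/-! ### The paired solution -/

/-- As `t` and `x` are real, `θ` commutes with conjugation of `z`. This turns the paired solution
into an ordinary dressed zero seed. -/
lemma orthVec_zeroSeedSolution (z p q : ℂ) (t x : ℝ) :
    orthVec (zeroSeedSolution z p q t x) = zeroSeedSolution (conj z) (-conj q) (conj p) t x := by
  ext i
  fin_cases i <;>
    simp [orthVec, zeroSeedSolution, theta, ← Complex.exp_conj, Complex.conj_ofNat]

lemma pairedSolution_eq (N : ℕ) (z p q ph qh : Fin N → ℂ) :
    pairedSolution N z p q ph qh = solitonSolution (Fin.append z fun j => conj (-z j))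
      (Fin.append p fun j => -conj (qh j)) (Fin.append q fun j => conj (ph j)) := by
  unfold pairedSolution solitonSolution
  congr 1
  funext j t x
  refine Fin.addCases (fun i => ?_) (fun i => ?_) j
  · simp only [Fin.append_left]
  · simp only [Fin.append_right, orthVec_zeroSeedSolution]

lemma injective_append_neg_conj {N : ℕ} {z : Fin N → ℂ} (hinj : Function.Injective z)
    (hpair : ∀ j k, z j ≠ conj (-z k)) :
    Function.Injective (Fin.append z fun j => conj (-z j)) := by
  rw [Fin.append_injective_iff]
  exact ⟨hinj, fun j k h => hinj (neg_injective (star_injective h)), hpair⟩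

/-- Replacing the missing factor by `1` gives a product over the whole type, which
`Fin.prod_univ_add` can split. -/
lemma prod_erase_eq_prod_update {ι : Type*} [Fintype ι] [DecidableEq ι] (f : ι → ℂ) (a : ι) :
    ∏ k ∈ Finset.univ.erase a, f k = ∏ k, Function.update f a 1 k := by
  rw [← Finset.prod_erase Finset.univ (Function.update_self a (1 : ℂ) f)]
  exact Finset.prod_congr rfl fun k hk =>
    (Function.update_of_ne (Finset.ne_of_mem_erase hk) _ _).symm

lemma prod_erase_castAdd {m n : ℕ} (f : Fin (m + n) → ℂ) (j : Fin m) :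
    ∏ k ∈ Finset.univ.erase (Fin.castAdd n j), f k =
      (∏ k ∈ Finset.univ.erase j, f (Fin.castAdd n k)) * ∏ k, f (Fin.natAdd m k) := by
  rw [prod_erase_eq_prod_update, prod_erase_eq_prod_update, Fin.prod_univ_add]
  congr 1
  · exact Finset.prod_congr rfl fun k _ => by
      simp [Function.update_apply]
  · exact Finset.prod_congr rfl fun k _ => by
      rw [Function.update_of_ne]
      intro h
      have := congrArg Fin.val h
      simp at this
      omega

lemma prod_erase_natAdd {m n : ℕ} (f : Fin (m + n) → ℂ) (j : Fin n) :
    ∏ k ∈ Finset.univ.erase (Fin.natAdd m j), f k =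
      (∏ k, f (Fin.castAdd n k)) * ∏ k ∈ Finset.univ.erase j, f (Fin.natAdd m k) := by
  rw [prod_erase_eq_prod_update, prod_erase_eq_prod_update, Fin.prod_univ_add]
  congr 1
  · exact Finset.prod_congr rfl fun k _ => by
      rw [Function.update_of_ne]
      intro h
      have := congrArg Fin.val h
      simp at this
      omega
  · exact Finset.prod_congr rfl fun k _ => by
      simp [Function.update_apply]

section

variable {N : ℕ} {z p q ph qh : Fin N → ℂ}

/-- The reflection `λ ↦ -λ*` exchanges the two halves of the spectrum, so the product at `-zⱼ*` is
the conjugate of the one at `zⱼ`. The second weight is written as a conjugate to display the common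
product. -/
lemma isWeight_pairedSolution (hinj : Function.Injective z) (hpair : ∀ j k, z j ≠ conj (-z k))
    (him : ∀ j, 0 < (z j).im) (hp : ∀ j, p j ≠ 0) (hq : ∀ j, q j ≠ 0) (hph : ∀ j, ph j ≠ 0)
    (hqh : ∀ j, qh j ≠ 0) (j : Fin N) :
    IsWeight (pairedSolution N z p q ph qh) (z j) (-(q j / p j) * (z j - conj (z j)) *
        ((∏ k ∈ Finset.univ.erase j, ((z j - conj (z k)) / (z j - z k))) *
          ∏ k, ((z j + z k) / (z j + conj (z k))))) ∧
      IsWeight (pairedSolution N z p q ph qh) (conj (-z j))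
        (conj (ph j / qh j * (conj (z j) - z j) *
        ((∏ k ∈ Finset.univ.erase j, ((z j - conj (z k)) / (z j - z k))) *
          ∏ k, ((z j + z k) / (z j + conj (z k)))))) := by
  have him' : ∀ j, 0 < ((Fin.append z fun j => conj (-z j)) j).im := fun j => by
    refine Fin.addCases (fun i => ?_) (fun i => ?_) j
    · simpa using him i
    · simpa only [Fin.append_right, ne_eq, neg_eq_zero, map_eq_zero, Complex.conj_im,
        Complex.neg_im, neg_neg] using him i
  have hp' : ∀ j, (Fin.append p fun j => -conj (qh j)) j ≠ 0 := fun j => by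
    refine Fin.addCases (fun i => ?_) (fun i => ?_) j
    · simpa using hp i
    · simpa only [Fin.append_right, ne_eq, neg_eq_zero, map_eq_zero, Complex.conj_im,
        Complex.neg_im, neg_neg] using hqh i
  have hq' : ∀ j, (Fin.append q fun j => conj (ph j)) j ≠ 0 := fun j => by
    refine Fin.addCases (fun i => ?_) (fun i => ?_) j
    · simpa using hq i
    · simpa only [Fin.append_right, ne_eq, neg_eq_zero, map_eq_zero, Complex.conj_im,
        Complex.neg_im, neg_neg] using hph i
  have h := isWeight_solitonSolution (injective_append_neg_conj hinj hpair) him' hp' hq'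
  rw [pairedSolution_eq]
  constructor
  · convert h (Fin.castAdd N j) using 1
    · rw [Fin.append_left]
    · rw [prod_erase_castAdd]
      simp only [Fin.append_left, Fin.append_right, map_neg, Complex.conj_conj, sub_neg_eq_add]
  · convert h (Fin.natAdd N j) using 1
    · rw [Fin.append_right]
    · rw [prod_erase_natAdd, mul_comm (∏ k, _)]
      simp only [Fin.append_left, Fin.append_right, map_mul, map_div₀, map_prod, map_sub, map_add,
        map_neg, Complex.conj_conj]
      congr 1
      · congr 1
        · rw [div_neg, neg_neg]
        · ring
      · congr 1
        · exact Finset.prod_congr rfl fun k _ => by rw [← neg_div_neg_eq]; congr 1 <;> ring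
        · exact Finset.prod_congr rfl fun k _ => by rw [← neg_div_neg_eq]; congr 1 <;> ring

end

/-! ### Positions, phases and the boundary matrix -/

lemma eq_mul_exp_position_phase {η : ℝ} (hη : 0 < η) {c : ℂ} (hc : c ≠ 0) :
    c = 2 * (η : ℂ) * Complex.exp
      (2 * (η : ℂ) * (position η c : ℝ) + Complex.I * (phase c : ℝ)) := by
  have h1 : 2 * η * position η c = Real.log (‖c‖ / (2 * η)) := by
    unfold position
    field_simp
  have h2 : (2 * (η : ℂ) * (position η c : ℝ)) = ((Real.log (‖c‖ / (2 * η)) : ℝ) : ℂ) := by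
    rw [← h1]
    push_cast
    ring
  have hpos : 0 < ‖c‖ / (2 * η) := div_pos (norm_pos_iff.2 hc) (by linarith)
  rw [h2, Complex.exp_add, ← Complex.ofReal_exp, Real.exp_log hpos, phase,
    mul_comm Complex.I, ← mul_assoc]
  have h3 : 2 * (η : ℂ) * ((‖c‖ / (2 * η) : ℝ) : ℂ) = ‖c‖ := by
    have : (η : ℂ) ≠ 0 := by exact_mod_cast hη.ne'
    push_cast
    field_simp
  rw [h3, Complex.norm_mul_exp_arg_mul_I]

lemma position_add_position {η : ℝ} (hη : 0 < η) {c d : ℂ} (hc : c ≠ 0) (hd : d ≠ 0) :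
    position η c + position η d = 1 / (2 * η) * Real.log (‖c * conj d‖ / (2 * η) ^ 2) := by
  have hc' := norm_ne_zero_iff.2 hc
  have hd' := norm_ne_zero_iff.2 hd
  rw [position, position, ← mul_add, ← Real.log_mul (by positivity) (by positivity), norm_mul,
    Complex.norm_conj, div_mul_div_comm, sq]

lemma phase_sub_phase {c d : ℂ} (hc : c ≠ 0) (hd : d ≠ 0) :
    ((phase c - phase d : ℝ) : Real.Angle) = Complex.arg (c * conj d) := by
  rw [Complex.arg_mul_coe_angle hc ((map_ne_zero _).2 hd), Complex.arg_conj_coe_angle,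
    Real.Angle.coe_sub, sub_eq_add_neg]
  rfl

lemma norm_ofReal_add_I_mul_sq (a b : ℝ) : ‖(a : ℂ) + Complex.I * (b : ℂ)‖ ^ 2 = a ^ 2 + b ^ 2 := by
  rw [mul_comm, Complex.sq_norm, Complex.normSq_add_mul_I]

/-- Modulo `2π` the argument is a homomorphism on nonzero numbers. -/
lemma arg_prod_coe_angle {ι : Type*} (s : Finset ι) {f : ι → ℂ} (h : ∀ k ∈ s, f k ≠ 0) :
    (Complex.arg (∏ k ∈ s, f k) : Real.Angle) = ((∑ k ∈ s, Complex.arg (f k) : ℝ) : Real.Angle) := by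
  classical
  induction s using Finset.induction_on with
  | empty => simp
  | insert a s ha ih =>
    rw [Finset.prod_insert ha, Finset.sum_insert ha, Real.Angle.coe_add,
      ← ih fun k hk => h k (Finset.mem_insert_of_mem hk),
      Complex.arg_mul_coe_angle (h a (Finset.mem_insert_self a s))
        (Finset.prod_ne_zero_iff.2 fun k hk => h k (Finset.mem_insert_of_mem hk))]

/-- The boundary matrix at boundary value zero, applied to a zero seed solution. -/
lemma coefficients_of_boundaryMatrix {α β : ℝ} {z p q ph qh : ℂ}
    (hden : (2 * z - Complex.I * (|β| : ℝ)) ^ 2 - (α : ℂ) ^ 2 ≠ 0)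
    (hK : zeroSeedSolution (-z) ph qh 0 0 = boundaryMatrix α β 0 z *ᵥ zeroSeedSolution z p q 0 0) :
    ph = ((2 * z + Complex.I * (|β| : ℝ)) ^ 2 - (α : ℂ) ^ 2) /
      ((2 * z - Complex.I * (|β| : ℝ)) ^ 2 - (α : ℂ) ^ 2) * p ∧ qh = q := by
  have hβ : ((|β| : ℝ) : ℂ) ^ 2 = (β : ℂ) ^ 2 := by exact_mod_cast sq_abs β
  have h1 : 4 * z ^ 2 + 4 * Complex.I * z * (|β| : ℝ) - ((α : ℂ) ^ 2 + (β : ℂ) ^ 2) =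
      (2 * z + Complex.I * (|β| : ℝ)) ^ 2 - (α : ℂ) ^ 2 := by
    linear_combination hβ - ((|β| : ℝ) : ℂ) ^ 2 * Complex.I_sq
  -- The lower diagonal entry equals the denominator, so the second coefficient is unchanged.
  have h2 : 4 * z ^ 2 - 4 * Complex.I * z * (|β| : ℝ) - ((α : ℂ) ^ 2 + (β : ℂ) ^ 2) =
      (2 * z - Complex.I * (|β| : ℝ)) ^ 2 - (α : ℂ) ^ 2 := by
    linear_combination hβ - ((|β| : ℝ) : ℂ) ^ 2 * Complex.I_sq
  have hΩ : Real.sqrt (β ^ 2 - ‖(0 : ℂ)‖ ^ 2) = |β| := by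
    rw [norm_zero, zero_pow two_ne_zero, sub_zero, Real.sqrt_sq_eq_abs]
  have e0 := congrFun hK 0
  have e1 := congrFun hK 1
  rw [boundaryMatrix] at e0 e1
  simp only [hΩ, h1, h2] at e0 e1
  simp only [zeroSeedSolution, theta, Matrix.smul_apply, smul_eq_mul,
    Matrix.mulVec, dotProduct, Fin.sum_univ_two, Matrix.of_apply, Matrix.cons_val_zero,
    Matrix.cons_val_one, Complex.ofReal_zero, mul_zero, add_zero, neg_zero, Complex.exp_zero,
    one_mul, zero_mul, map_zero, zero_add] at e0 e1
  constructor
  · rw [e0]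
    ring
  · rw [e1, inv_mul_cancel₀ hden, one_mul]

/-- The zeros of the denominator are `(±α + i|β|) / 2`; the sign of `β` decides which two of the
four excluded points they are. -/
lemma mem_of_sq_eq_zero {α β : ℝ} {z : ℂ}
    (h : (2 * z - Complex.I * (|β| : ℝ)) ^ 2 - (α : ℂ) ^ 2 = 0) :
    z ∈ ({-((α : ℂ) + Complex.I * β) / 2, conj (-((α : ℂ) + Complex.I * β) / 2),
      ((α : ℂ) + Complex.I * β) / 2, conj (((α : ℂ) + Complex.I * β) / 2)} : Set ℂ) := by
  simp only [Set.mem_insert_iff, Set.mem_singleton_iff, map_div₀, map_neg, map_add, map_mul,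
    Complex.conj_I, Complex.conj_ofReal, Complex.conj_ofNat]
  rcases sq_eq_sq_iff_eq_or_eq_neg.1 (sub_eq_zero.1 h) with h | h <;>
    rcases abs_choice β with hb | hb <;> rw [hb] at h
  · right; right; left; linear_combination h / 2
  · right; right; right; push_cast at h; linear_combination h / 2
  · right; left; linear_combination h / 2
  · left; push_cast at h; linear_combination h / 2

/-- The zeros have imaginary part `-|β| / 2`, outside the open upper half plane. -/
lemma sq_add_ne_zero {α β : ℝ} {z : ℂ} (hz : 0 < z.im) :
    (2 * z + Complex.I * (|β| : ℝ)) ^ 2 - (α : ℂ) ^ 2 ≠ 0 := by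
  intro h
  have hb := abs_nonneg β
  rcases sq_eq_sq_iff_eq_or_eq_neg.1 (sub_eq_zero.1 h) with h | h <;>
  · have := congrArg Complex.im h
    simp at this
    linarith

lemma weight_mul_conj_weight {z p q ph qh r S T : ℂ} {ξ η : ℝ} (hp : p ≠ 0) (hq : q ≠ 0)
    (hph : ph = r * p) (hqh : qh = q) (hξ : ξ ≠ 0) (h : z - conj z = 2 * η * Complex.I)
    (h' : conj z - z = -(2 * η * Complex.I)) (hS : S = z / ξ * T) :
    -(q / p) * (z - conj z) * S * conj (conj (ph / qh * (conj z - z) * S)) =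
      -4 * z ^ 2 * r * ((2 * (η : ℂ)) ^ 2 / (2 * (ξ : ℂ)) ^ 2) * T ^ 2 := by
  have hξ' : (ξ : ℂ) ≠ 0 := by exact_mod_cast hξ
  rw [Complex.conj_conj, h, h', hph, hqh, hS]
  field_simp
  linear_combination 4 * (η : ℂ) ^ 2 * z ^ 2 * T ^ 2 * r * Complex.I_sq

lemma log_norm_weight_product {ι : Type*} {s : Finset ι} {ξ η : ℝ} (hξ : ξ ≠ 0) (hη : 0 < η)
    {z R : ℂ} {X : ι → ℂ} (hz : z = ξ + η * Complex.I) (hR : R ≠ 0) (hX : ∀ k ∈ s, X k ≠ 0) :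
    Real.log (‖-4 * z ^ 2 * R * ((2 * (η : ℂ)) ^ 2 / (2 * (ξ : ℂ)) ^ 2) *
      (∏ k ∈ s, (X k)⁻¹) ^ 2‖ / (2 * η) ^ 2) =
      Real.log (1 + η ^ 2 / ξ ^ 2) + 1 / 2 * Real.log (‖R‖ ^ 2) -
        ∑ k ∈ s, Real.log (‖X k‖ ^ 2) := by
  have hz2 : ‖z‖ ^ 2 = ξ ^ 2 + η ^ 2 := by rw [hz, Complex.sq_norm, Complex.normSq_add_mul_I]
  have h : ‖-4 * z ^ 2 * R * ((2 * (η : ℂ)) ^ 2 / (2 * (ξ : ℂ)) ^ 2) *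
      (∏ k ∈ s, (X k)⁻¹) ^ 2‖ / (2 * η) ^ 2 =
      (1 + η ^ 2 / ξ ^ 2) * ‖R‖ * ∏ k ∈ s, (‖X k‖ ^ 2)⁻¹ := by
    simp only [norm_mul, norm_neg, norm_pow, norm_div, norm_prod, norm_inv, Complex.norm_real,
      Real.norm_eq_abs, mul_pow, sq_abs, hz2, Finset.prod_inv_distrib, Finset.prod_pow, inv_pow,
      Complex.norm_ofNat]
    field_simp
    ring
  rw [h, Real.log_mul (mul_ne_zero (by positivity) (norm_ne_zero_iff.2 hR))
    (Finset.prod_ne_zero_iff.2 fun k hk =>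
      inv_ne_zero (pow_ne_zero 2 (norm_ne_zero_iff.2 (hX k hk)))),
    Real.log_mul (by positivity) (norm_ne_zero_iff.2 hR),
    Real.log_prod fun k hk => inv_ne_zero (pow_ne_zero 2 (norm_ne_zero_iff.2 (hX k hk)))]
  simp only [Real.log_inv, Real.log_pow, Finset.sum_neg_distrib]
  push_cast
  ring

/-- Positive real factors drop out, the sign contributes `π`, squares double the argument and
inverses negate it. -/
lemma arg_weight_product {ι : Type*} {s : Finset ι} {ξ η : ℝ} (hξ : ξ ≠ 0) (hη : 0 < η)
    {z R : ℂ} {X : ι → ℂ} (hz : z ≠ 0) (hR : R ≠ 0) (hX : ∀ k ∈ s, X k ≠ 0) :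
    (Complex.arg (-4 * z ^ 2 * R * ((2 * (η : ℂ)) ^ 2 / (2 * (ξ : ℂ)) ^ 2) *
      (∏ k ∈ s, (X k)⁻¹) ^ 2) : Real.Angle) =
      ((2 * Complex.arg z + Complex.arg R + Real.pi - 2 * ∑ k ∈ s, Complex.arg (X k) : ℝ) :
        Real.Angle) := by
  have hP : ∏ k ∈ s, X k ≠ 0 := Finset.prod_ne_zero_iff.2 hX
  have hP' : (∏ k ∈ s, X k)⁻¹ ^ 2 ≠ 0 := pow_ne_zero 2 (inv_ne_zero hP)
  have hzR : z ^ 2 * R ≠ 0 := mul_ne_zero (pow_ne_zero 2 hz) hR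
  have h : -4 * z ^ 2 * R * ((2 * (η : ℂ)) ^ 2 / (2 * (ξ : ℂ)) ^ 2) * (∏ k ∈ s, (X k)⁻¹) ^ 2 =
      ((4 * ((2 * η) ^ 2 / (2 * ξ) ^ 2) : ℝ) : ℂ) * -(z ^ 2 * R * (∏ k ∈ s, X k)⁻¹ ^ 2) := by
    rw [Finset.prod_inv_distrib]
    push_cast
    ring
  rw [h, Complex.arg_real_mul _ (by positivity),
    Complex.arg_neg_coe_angle (mul_ne_zero hzR hP'), Complex.arg_mul_coe_angle hzR hP',
    Complex.arg_mul_coe_angle (pow_ne_zero 2 hz) hR, Complex.arg_pow_coe_angle,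
    Complex.arg_pow_coe_angle, Complex.arg_inv_coe_angle, arg_prod_coe_angle s hX]
  simp only [Real.Angle.coe_sub, Real.Angle.coe_add, two_mul, two_nsmul]
  abel

end NLSDressing

theorem mainTheorem4 (N : ℕ) (α β : ℝ) (hα : α ≠ 0) (hβ : β ≠ 0)
    (ξ η : Fin N → ℝ) (z : Fin N → ℂ)
    (hz : ∀ j, z j = (ξ j : ℂ) + (η j : ℂ) * Complex.I)
    (hξ : ∀ j, ξ j ≠ 0) (hη : ∀ j, 0 < η j)
    -- the `2N` spectral parameters are distinct
    (hinj : Function.Injective z) (hpair : ∀ j k, z j ≠ conj (-z k))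
    (hexc : ∀ j, z j ∉ ({-((α : ℂ) + Complex.I * β) / 2, conj (-((α : ℂ) + Complex.I * β) / 2),
      ((α : ℂ) + Complex.I * β) / 2, conj (((α : ℂ) + Complex.I * β) / 2)} : Set ℂ))
    (p q ph qh : Fin N → ℂ) (hp : ∀ j, p j ≠ 0) (hq : ∀ j, q j ≠ 0)
    -- the paired solutions are related through the boundary matrix at `x = 0`
    (hK : ∀ j, ∀ t : ℝ, 0 ≤ t → zeroSeedSolution (-z j) (ph j) (qh j) t 0 =
      boundaryMatrix α β 0 (z j) *ᵥ zeroSeedSolution (z j) (p j) (q j) t 0) :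
    ∃ C Ch : Fin N → ℂ, ∀ j,
      -- `C j` and `Ch j` are the weights at the paired spectral parameters, and they are nonzero
      (∀ c, IsWeight (pairedSolution N z p q ph qh) (z j) c ↔ c = C j) ∧
      (∀ c, IsWeight (pairedSolution N z p q ph qh) (conj (-z j)) c ↔ c = Ch j) ∧
      C j = 2 * (η j : ℂ) * Complex.exp
        (2 * (η j : ℂ) * (position (η j) (C j) : ℝ) + Complex.I * (phase (C j) : ℝ)) ∧
      Ch j = 2 * (η j : ℂ) * Complex.exp
        (2 * (η j : ℂ) * (position (η j) (Ch j) : ℝ) + Complex.I * (phase (Ch j) : ℝ)) ∧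
      -- the product of the weights
      C j * conj (Ch j) =
        -4 * z j ^ 2 *
          (((2 * z j + Complex.I * (|β| : ℝ)) ^ 2 - (α : ℂ) ^ 2) /
            ((2 * z j - Complex.I * (|β| : ℝ)) ^ 2 - (α : ℂ) ^ 2)) *
          ((2 * (η j : ℂ)) ^ 2 / (2 * (ξ j : ℂ)) ^ 2) *
          (∏ k ∈ Finset.univ.erase j,
            ((z j - conj (z k)) * (z j + z k)) / ((z j - z k) * (z j + conj (z k)))) ^ 2 ∧
      -- the positions
      position (η j) (C j) + position (η j) (Ch j) =
        1 / (2 * η j) * Real.log (1 + η j ^ 2 / ξ j ^ 2) +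
        1 / (4 * η j) * Real.log
          (((4 * ξ j ^ 2 - α ^ 2 - (2 * η j + |β|) ^ 2) ^ 2 + (4 * ξ j * (2 * η j + |β|)) ^ 2) /
            ((4 * ξ j ^ 2 - α ^ 2 - (2 * η j - |β|) ^ 2) ^ 2 + (4 * ξ j * (2 * η j - |β|)) ^ 2)) -
        1 / (2 * η j) * ∑ k ∈ Finset.univ.erase j, Real.log
          ((((ξ j - ξ k) ^ 2 + (η j - η k) ^ 2) * ((ξ j + ξ k) ^ 2 + (η j - η k) ^ 2)) /
            (((ξ j + ξ k) ^ 2 + (η j + η k) ^ 2) * ((ξ j - ξ k) ^ 2 + (η j + η k) ^ 2))) ∧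
      -- the phases, modulo `2π`
      ((phase (C j) - phase (Ch j) : ℝ) : Real.Angle) =
        ((2 * Complex.arg (z j) +
          Complex.arg
            ((((4 * ξ j ^ 2 - α ^ 2 - (2 * η j + |β|) ^ 2 : ℝ) : ℂ) +
                Complex.I * ((4 * ξ j * (2 * η j + |β|) : ℝ) : ℂ)) /
              (((4 * ξ j ^ 2 - α ^ 2 - (2 * η j - |β|) ^ 2 : ℝ) : ℂ) +
                Complex.I * ((4 * ξ j * (2 * η j - |β|) : ℝ) : ℂ))) +
          Real.pi -
          2 * ∑ k ∈ Finset.univ.erase j, Complex.arg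
            (((((ξ j - ξ k : ℝ) : ℂ) + Complex.I * ((η j - η k : ℝ) : ℂ)) *
                (((ξ j + ξ k : ℝ) : ℂ) + Complex.I * ((η j - η k : ℝ) : ℂ))) /
              ((((ξ j + ξ k : ℝ) : ℂ) + Complex.I * ((η j + η k : ℝ) : ℂ)) *
                (((ξ j - ξ k : ℝ) : ℂ) + Complex.I * ((η j + η k : ℝ) : ℂ)))) : ℝ) :
          Real.Angle) := by
  have him : ∀ j, 0 < (z j).im := fun j => by simpa [hz] using hη j
  have hden : ∀ j, (2 * z j - Complex.I * (|β| : ℝ)) ^ 2 - (α : ℂ) ^ 2 ≠ 0 :=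
    fun j h => hexc j (mem_of_sq_eq_zero h)
  have hnum : ∀ j, (2 * z j + Complex.I * (|β| : ℝ)) ^ 2 - (α : ℂ) ^ 2 ≠ 0 :=
    fun j => sq_add_ne_zero (him j)
  -- At `t = x = 0` all exponentials equal `1`, so the boundary relation becomes one between
  -- coefficients.
  have hcoef := fun j => coefficients_of_boundaryMatrix (hden j) (hK j 0 le_rfl)
  have hph : ∀ j, ph j ≠ 0 := fun j => by
    rw [(hcoef j).1]
    exact mul_ne_zero (div_ne_zero (hnum j) (hden j)) (hp j)
  have hqh : ∀ j, qh j ≠ 0 := fun j => by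
    rw [(hcoef j).2]
    exact hq j
  have hw := isWeight_pairedSolution hinj hpair him hp hq hph hqh
  have hsub : ∀ j k, z j - conj (z k) ≠ 0 := fun j k h => by
    have := congrArg Complex.im h
    simp at this
    linarith [him j, him k]
  have hadd : ∀ j k, z j + z k ≠ 0 := fun j k h => by
    have := congrArg Complex.im h
    simp at this
    linarith [him j, him k]
  -- For `k = j` this says that `ξ j` is nonzero.
  have hadd' : ∀ j k, z j + conj (z k) ≠ 0 := fun j k h =>
    hpair j k (by rw [map_neg]; exact eq_neg_of_add_eq_zero_left h)
  have hsub' : ∀ j, ∀ k ∈ Finset.univ.erase j, z j - z k ≠ 0 := fun j k hk h =>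
    Finset.ne_of_mem_erase hk (hinj (sub_eq_zero.1 h)).symm
  -- The witnesses are the explicit weights from `hw`, filled in by unification.
  refine ⟨fun j => _, fun j => _, fun j =>
    ⟨fun c => ⟨fun h => h.unique (hw j).1, fun h => h ▸ (hw j).1⟩,
    fun c => ⟨fun h => h.unique (hw j).2, fun h => h ▸ (hw j).2⟩, ?_⟩⟩
  have hS : (∏ k ∈ Finset.univ.erase j, ((z j - conj (z k)) / (z j - z k))) *
      ∏ k, ((z j + z k) / (z j + conj (z k))) ≠ 0 :=
    mul_ne_zero
      (Finset.prod_ne_zero_iff.2 fun k hk => div_ne_zero (hsub j k) (hsub' j k hk))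
      (Finset.prod_ne_zero_iff.2 fun k _ => div_ne_zero (hadd j k) (hadd' j k))
  -- The `k = j` factor of the second product is `2 zⱼ / (2 ξⱼ)`; this is the source of the factors
  -- `zⱼ²` and `ξⱼ⁻²`.
  have hS' : (∏ k ∈ Finset.univ.erase j, ((z j - conj (z k)) / (z j - z k))) *
      ∏ k, ((z j + z k) / (z j + conj (z k))) = (z j / ξ j) * ∏ k ∈ Finset.univ.erase j,
        ((z j - conj (z k)) * (z j + z k)) / ((z j - z k) * (z j + conj (z k))) := by
    rw [← Finset.mul_prod_erase _ _ (Finset.mem_univ j), mul_left_comm, ← Finset.prod_mul_distrib]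
    congr 1
    · have : z j + conj (z j) = 2 * ξ j := by
        rw [hz]
        simp
        ring
      rw [this, ← two_mul, mul_div_mul_left _ _ two_ne_zero]
    · exact Finset.prod_congr rfl fun k _ => div_mul_div_comm _ _ _ _
  have hdiff : z j - conj (z j) = 2 * η j * Complex.I := by
    rw [hz]
    simp
    ring
  have hdiff' : conj (z j) - z j = -(2 * η j * Complex.I) := by rw [← hdiff, neg_sub]
  have hne : z j - conj (z j) ≠ 0 := hsub j j
  have hC : -(q j / p j) * (z j - conj (z j)) *
      ((∏ k ∈ Finset.univ.erase j, ((z j - conj (z k)) / (z j - z k))) *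
          ∏ k, ((z j + z k) / (z j + conj (z k)))) ≠ 0 :=
    mul_ne_zero (mul_ne_zero (neg_ne_zero.2 (div_ne_zero (hq j) (hp j))) hne) hS
  have hCh : conj (ph j / qh j * (conj (z j) - z j) *
      ((∏ k ∈ Finset.univ.erase j, ((z j - conj (z k)) / (z j - z k))) *
          ∏ k, ((z j + z k) / (z j + conj (z k))))) ≠ 0 :=
    (map_ne_zero _).2 (mul_ne_zero (mul_ne_zero (div_ne_zero (hph j) (hqh j))
      (by rw [← neg_sub]; exact neg_ne_zero.2 hne)) hS)
  dsimp only
  have hprod := weight_mul_conj_weight (S := (∏ k ∈ Finset.univ.erase j,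
    ((z j - conj (z k)) / (z j - z k))) * ∏ k, ((z j + z k) / (z j + conj (z k))))
    (hp j) (hq j) (hcoef j).1 (hcoef j).2 (hξ j) hdiff hdiff' hS'
  have hR : ((2 * z j + Complex.I * (|β| : ℝ)) ^ 2 - (α : ℂ) ^ 2) /
      ((2 * z j - Complex.I * (|β| : ℝ)) ^ 2 - (α : ℂ) ^ 2) =
      (((4 * ξ j ^ 2 - α ^ 2 - (2 * η j + |β|) ^ 2 : ℝ) : ℂ) +
        Complex.I * ((4 * ξ j * (2 * η j + |β|) : ℝ) : ℂ)) /
      (((4 * ξ j ^ 2 - α ^ 2 - (2 * η j - |β|) ^ 2 : ℝ) : ℂ) +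
        Complex.I * ((4 * ξ j * (2 * η j - |β|) : ℝ) : ℂ)) := by
    rw [hz]
    push_cast
    congr 1
    · linear_combination (2 * (η j : ℂ) + ((|β| : ℝ) : ℂ)) ^ 2 * Complex.I_sq
    · linear_combination (2 * (η j : ℂ) - ((|β| : ℝ) : ℂ)) ^ 2 * Complex.I_sq
  -- The quotients in the position and phase formulas are the inverses of the factors in the weight
  -- formula, hence the minus signs before the sums.
  have hX : ∀ k, ((z j - conj (z k)) * (z j + z k)) / ((z j - z k) * (z j + conj (z k))) =
      ((((ξ j - ξ k : ℝ) : ℂ) + Complex.I * ((η j - η k : ℝ) : ℂ)) *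
        (((ξ j + ξ k : ℝ) : ℂ) + Complex.I * ((η j - η k : ℝ) : ℂ)) /
      ((((ξ j + ξ k : ℝ) : ℂ) + Complex.I * ((η j + η k : ℝ) : ℂ)) *
        (((ξ j - ξ k : ℝ) : ℂ) + Complex.I * ((η j + η k : ℝ) : ℂ))))⁻¹ := fun k => by
    rw [inv_div, hz, hz]
    simp only [map_add, map_mul, Complex.conj_ofReal, Complex.conj_I]
    push_cast
    congr 1 <;> ring
  have hR0 := hR ▸ div_ne_zero (hnum j) (hden j)
  have hX0 : ∀ k ∈ Finset.univ.erase j,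
      (((ξ j - ξ k : ℝ) : ℂ) + Complex.I * ((η j - η k : ℝ) : ℂ)) *
        (((ξ j + ξ k : ℝ) : ℂ) + Complex.I * ((η j - η k : ℝ) : ℂ)) /
      ((((ξ j + ξ k : ℝ) : ℂ) + Complex.I * ((η j + η k : ℝ) : ℂ)) *
        (((ξ j - ξ k : ℝ) : ℂ) + Complex.I * ((η j + η k : ℝ) : ℂ))) ≠ 0 := fun k hk h0 =>
    div_ne_zero (mul_ne_zero (hsub j k) (hadd j k)) (mul_ne_zero (hsub' j k hk) (hadd' j k))
      ((hX k).trans (inv_eq_zero.2 h0))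
  refine ⟨eq_mul_exp_position_phase (hη j) hC, eq_mul_exp_position_phase (hη j) hCh, hprod, ?_, ?_⟩
  · rw [position_add_position (hη j) hC hCh, hprod, hR, Finset.prod_congr rfl fun k _ => hX k,
      log_norm_weight_product (hξ j) (hη j) (hz j) hR0 hX0]
    simp only [norm_div, norm_mul, div_pow, mul_pow, norm_ofReal_add_I_mul_sq]
    ring
  · rw [phase_sub_phase hC hCh, hprod, hR, Finset.prod_congr rfl fun k _ => hX k]
    exact arg_weight_product (hξ j) (hη j) (fun h => (him j).ne' (by rw [h]; rfl)) hR0 hX0
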